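/- Let $\{0,1\}^n$ be the vertex set of the hypercube graph $Q_n$, in which two vectors are adjacent when they differ in exactly one coordinate. For $A\subset\{0,1\}^n$ let $\partial A$ be the set of edges of $Q_n$ joining a point of $A$ to a point not in $A$. A subcube of codimension $N$ is a set of all vectors in $\{0,1\}^n$ having prescribed values on some set of exactly $N$ coordinates. For every $0<\varepsilon<\frac{1}{e\ln 2}$ the equation $x\log_2(1/x)=\varepsilon$ has a unique root in $(0,1/e)$; denote it by $\delta_1(\varepsilon)$, and put $\delta_1(\varepsilon)=0$ for $\varepsilon\le 0$. **Theorem.** There is an absolute constant $c$ with $0<c<\frac1{e\ln 2}$ such that the following holds. Let $0\le N\le n$ be integers, let $A\subset\{0,1\}^n$ with $|A|=2^{n-N}$, and let $\varepsilon\le c$ be a real number with $$|\partial A|\le |A|\left(\log_2(2^n/|A|)+\varepsilon\right).$$ Then there is a subcube $C$ of codimension $N$ such that $|A\,\Delta\, C|\le\delta_1(\varepsilon)\,|A|$. The bound is sharp in the following sense. For all integers $N\ge1$, $j\ge1$ and $n\ge N+j+1$ there is a set $A\subset\{0,1\}^n$ with $|A|=2^{n-N}$ and $$|\partial A|=|A|\left(\log_2(2^n/|A|)+j2^{-j}\right),$$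 such that $|A\,\Delta\, C|=2^{-j}|A|$ for some subcube $C$ of codimension $N$, and $|A\,\Delta\, C'|\ge 2^{-j}|A|$ for every subcube $C'$ of any codimension. Moreover $\delta_1(j2^{-j})=2^{-j}$ for every integer $j\ge2$, so equality holds in the bound of the theorem for these sets whenever $j2^{-j}\le c$. -/

import Mathlib

open scoped symmDiff

/-- The `n`-dimensional hypercube `Q_n`: the graph on `{0,1}^n` in which two 0-1 vectors are
adjacent when they differ in exactly one coordinate. -/
def hypercube (n : ℕ) : SimpleGraph (Fin n → Bool) where
  Adj x y := hammingDist x y = 1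
  symm := ⟨fun x y h => by rw [hammingDist_comm]; exact h⟩
  loopless := ⟨fun x h => by simp at h⟩

/-- The edge-boundary of `A`: the set of all (undirected) edges of `Q_n` joining a point of `A`
to a point not in `A`. -/
def edgeBoundary {n : ℕ} (A : Finset (Fin n → Bool)) : Set (Sym2 (Fin n → Bool)) :=
  {e | e ∈ (hypercube n).edgeSet ∧ ∃ x y, x ∈ A ∧ y ∉ A ∧ e = s(x, y)}

/-- `C` is a subcube of `{0,1}^n` of codimension `N`: the set of all 0-1 vectors taking prescribed
values on a set of exactly `N` fixed coordinates. -/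
def IsSubcubeOfCodim {n : ℕ} (N : ℕ) (C : Finset (Fin n → Bool)) : Prop :=
  ∃ (S : Finset (Fin n)) (a : Fin n → Bool), S.card = N ∧ ∀ x, x ∈ C ↔ ∀ i ∈ S, x i = a i

/-- `x` is a root of `x log₂(1/x) = ε` in the open interval `(0, 1/e)`. -/
def IsEntropyRoot (ε x : ℝ) : Prop :=
  x ∈ Set.Ioo 0 (1 / Real.exp 1) ∧ x * Real.logb 2 (1 / x) = ε

open Classical in
/-- `δ₁(ε)`: the root of `x log₂(1/x) = ε` in `(0, 1/e)`. It exists (and is unique) exactly for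
`0 < ε < 1/(e ln 2)`; elsewhere the value is `0`, in particular `δ₁(0) = 0`. -/
noncomputable def deltaOne (ε : ℝ) : ℝ :=
  if h : ∃ x, IsEntropyRoot ε x then h.choose else 0

/-!
The proof rests on the *excess* of `A` over the isoperimetric bound, relative to a set `S` of
directions: the number of boundary edges of `A` in the directions of `S`, minus
`|A| (|S| - log₂ |A|)`. Working with sets of directions lets every subcube be treated in place.

*Isoperimetry.* Halving the cube in a direction splits the excess into those of the two halves and
two nonnegative quantities: the surplus of the boundary in that direction over the difference of
the sizes of the halves, and an entropy term `H(p) - 2p` (`le_excess_insert`). By induction the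
excess is nonnegative (`excess_nonneg`).

*Exact bound near a subcube.* Let `C` be a subcube of codimension `N`. The edges of the boundary of
`A` inside `C` form the boundary of `C \ A` inside `C`; every point of `C` has `N` edges that leave
`C`; and every point of `A \ C` has at most one neighbour in `C`. Applying isoperimetry to `C \ A`
inside `C` and to `A \ C` in the whole cube gives `le_excess_of_cube`. For `|A| = |C|` and
`|A ∆ C| = δ |A|` it says precisely that the normalised excess is at least `δ log₂ (1 / δ)`.

*Rough closeness.* What remains is to find a subcube for which `δ < 1 / e`, the range where
`x log₂ (1 / x)` increases. This is done for sets of any size, by induction on the dimension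
(`exists_cube_of_excess_le`). If the excess is small then in each direction the entropy term
forces `p ≈ 0` or `p ≈ 1/2`. For `p ≈ 0` the large half again has small excess, and the small half
is negligible. For `p ≈ 1/2` one of the halves has small excess, and the two halves are nearly
reflections of each other. Either way a subcube near a half gives one roughly near `A`, and
`le_excess_of_cube` upgrades rough closeness to the constant needed for the induction.

*Sharpness.* All the inequalities used for `le_excess_of_cube` are equalities when `C \ A` and
`A \ C` are subcubes of the same size and every point of `A \ C` has a neighbour in `A ∩ C`
(`exists_extremal`).
-/

namespace Hypercube

/-! ### The function `x log₂ x` and its inverse branch -/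

/-- The convex function `x log₂ x`. -/
noncomputable def phi (x : ℝ) : ℝ := x * Real.logb 2 x

@[simp] lemma phi_zero : phi 0 = 0 := by simp [phi]

@[simp] lemma phi_one : phi 1 = 0 := by simp [phi]

lemma phi_mul (x y : ℝ) : phi (x * y) = x * phi y + y * phi x := by
  by_cases hx : x = 0
  · simp [hx]
  by_cases hy : y = 0
  · simp [hy]
  rw [phi, phi, phi, Real.logb_mul hx hy]; ring

lemma sub_one_le_logb_two {u : ℝ} (h1 : 1 ≤ u) (h2 : u ≤ 2) : u - 1 ≤ Real.logb 2 u := by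
  rw [Real.le_logb_iff_rpow_le one_lt_two (by linarith)]
  have := rpow_one_add_le_one_add_mul_self (s := 1) (p := u - 1) (by norm_num)
    (by linarith) (by linarith)
  norm_num at this
  exact this

/-- A superadditivity estimate for `x log₂ x`: the entropy inequality `H(p) ≥ 2p` for `p ≤ 1/2`,
with a remainder term that vanishes only at `p = 0` and `p = 1/2`. -/
lemma phi_add_ge {x y : ℝ} (hx : 0 ≤ x) (hxy : x ≤ y) :
    2 * x + x * Real.logb 2 ((x + y) / (2 * x)) ≤ phi (x + y) - phi x - phi y := by
  rcases hx.eq_or_lt with rfl | hx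
  · simp
  have hy : 0 < y := hx.trans_le hxy
  have hs : 0 < x + y := by positivity
  have h1 := sub_one_le_logb_two (u := (x + y) / y) (by rw [le_div_iff₀ hy]; linarith)
    (by rw [div_le_iff₀ hy]; linarith)
  have h2 := mul_le_mul_of_nonneg_left h1 hy.le
  have h3 : y * ((x + y) / y - 1) = x := by field_simp; ring
  rw [h3, Real.logb_div hs.ne' hy.ne'] at h2
  rw [Real.logb_div hs.ne' (by positivity), Real.logb_mul two_ne_zero hx.ne',
    Real.logb_self_eq_one one_lt_two]
  unfold phi
  linarith

/-- The tangent line of `x log₂ x` at `1`. -/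
lemma le_phi {a : ℝ} (ha : 0 < a) : (a - 1) / Real.log 2 ≤ phi a := by
  rw [phi, Real.logb, ← mul_div_assoc]
  refine div_le_div_of_nonneg_right ?_ (Real.log_pos one_lt_two).le
  have := Real.one_sub_inv_le_log_of_pos ha
  have h := mul_le_mul_of_nonneg_left this ha.le
  rwa [mul_sub, mul_one, mul_inv_cancel₀ ha.ne'] at h

lemma phi_le_of_le_pow {x : ℝ} (hx : 0 ≤ x) {k : ℕ} (h : x ≤ (1 / 2) ^ k) :
    phi x ≤ -(k * x) := by
  rcases hx.eq_or_lt with rfl | hx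
  · simp
  have : Real.logb 2 x ≤ -k := by
    rw [Real.logb_le_iff_le_rpow one_lt_two hx, Real.rpow_neg two_pos.le, Real.rpow_natCast]
    simpa using h
  have := mul_le_mul_of_nonneg_left this hx.le
  unfold phi
  linarith

lemma mul_logb_one_div (x : ℝ) : x * Real.logb 2 (1 / x) = -phi x := by
  simp [phi]

lemma neg_phi_eq (x : ℝ) : -phi x = Real.negMulLog x / Real.log 2 := by
  rw [phi, Real.negMulLog, Real.logb]; ring

/-- `x log₂ x` is strictly decreasing up to `1 / e`. -/
lemma phi_strictAntiOn : StrictAntiOn phi (Set.Icc 0 (1 / Real.exp 1)) := by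
  have he := Real.exp_pos 1
  have h : StrictMonoOn Real.negMulLog (Set.Icc 0 (1 / Real.exp 1)) := by
    refine strictMonoOn_of_deriv_pos (convex_Icc _ _) Real.continuous_negMulLog.continuousOn ?_
    intro x hx
    rw [interior_Icc] at hx
    rw [Real.deriv_negMulLog hx.1.ne']
    have := Real.log_lt_log hx.1 hx.2
    rw [one_div, Real.log_inv, Real.log_exp] at this
    linarith
  intro x hx y hy hxy
  have h1 := div_lt_div_of_pos_right (h hx hy hxy) (Real.log_pos one_lt_two)
  rw [← neg_phi_eq, ← neg_phi_eq] at h1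
  linarith

lemma isEntropyRoot_iff {ε x : ℝ} :
    IsEntropyRoot ε x ↔ x ∈ Set.Ioo 0 (1 / Real.exp 1) ∧ -phi x = ε := by
  rw [IsEntropyRoot, mul_logb_one_div]

lemma isEntropyRoot_unique {ε x y : ℝ} (hx : IsEntropyRoot ε x) (hy : IsEntropyRoot ε y) :
    x = y := by
  rw [isEntropyRoot_iff] at hx hy
  exact phi_strictAntiOn.injOn (Set.Ioo_subset_Icc_self hx.1) (Set.Ioo_subset_Icc_self hy.1)
    (by linarith)

lemma exists_isEntropyRoot {ε : ℝ} (h0 : 0 < ε) (h1 : ε < 1 / (Real.exp 1 * Real.log 2)) :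
    ∃ x, IsEntropyRoot ε x := by
  have hl := Real.log_pos one_lt_two
  have he := Real.exp_pos 1
  have hcont : ContinuousOn (fun x => Real.negMulLog x / Real.log 2)
      (Set.Icc 0 (1 / Real.exp 1)) := (Real.continuous_negMulLog.div_const _).continuousOn
  have hend : Real.negMulLog (1 / Real.exp 1) / Real.log 2 = 1 / (Real.exp 1 * Real.log 2) := by
    rw [Real.negMulLog, one_div, Real.log_inv, Real.log_exp]; field_simp
  obtain ⟨x, hx, hxe⟩ := intermediate_value_Ioo (by positivity) hcont
    (show ε ∈ Set.Ioo _ _ by simpa only [hend, Real.negMulLog_zero, zero_div] using ⟨h0, h1⟩)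
  exact ⟨x, isEntropyRoot_iff.2 ⟨hx, by rw [neg_phi_eq]; exact hxe⟩⟩

lemma isEntropyRoot_deltaOne {ε : ℝ} (h : ∃ x, IsEntropyRoot ε x) :
    IsEntropyRoot ε (deltaOne ε) := by
  rw [deltaOne, dif_pos h]; exact h.choose_spec

lemma deltaOne_nonneg (ε : ℝ) : 0 ≤ deltaOne ε := by
  by_cases h : ∃ x, IsEntropyRoot ε x
  · exact (isEntropyRoot_deltaOne h).1.1.le
  · rw [deltaOne, dif_neg h]

/-- `δ₁(ε)` bounds every small `δ` with `δ log₂ (1/δ) ≤ ε`. -/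
lemma le_deltaOne {ε δ : ℝ} (hε : ε < 1 / (Real.exp 1 * Real.log 2)) (h0 : 0 ≤ δ)
    (h1 : δ < 1 / Real.exp 1) (h : -phi δ ≤ ε) : δ ≤ deltaOne ε := by
  rcases h0.eq_or_lt with rfl | h0
  · exact deltaOne_nonneg ε
  have hmem : δ ∈ Set.Icc 0 (1 / Real.exp 1) := ⟨h0.le, h1.le⟩
  have hpos : 0 < -phi δ := by
    have := phi_strictAntiOn (Set.left_mem_Icc.2 (by positivity)) hmem h0
    rw [phi_zero] at this
    linarith
  have hr := isEntropyRoot_iff.1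
    (isEntropyRoot_deltaOne (exists_isEntropyRoot (hpos.trans_le h) hε))
  exact (phi_strictAntiOn.le_iff_ge (Set.Ioo_subset_Icc_self hr.1) hmem).1 (by linarith)

lemma deltaOne_two_pow {j : ℕ} (hj : 2 ≤ j) :
    deltaOne ((j : ℝ) * (1 / 2 : ℝ) ^ j) = (1 / 2 : ℝ) ^ j := by
  have h : IsEntropyRoot ((j : ℝ) * (1 / 2 : ℝ) ^ j) ((1 / 2 : ℝ) ^ j) := by
    refine ⟨⟨by positivity, ?_⟩, ?_⟩
    · calc (1 / 2 : ℝ) ^ j ≤ (1 / 2) ^ 2 :=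
            pow_le_pow_of_le_one (by norm_num) (by norm_num) hj
        _ < 1 / Real.exp 1 := by
            rw [lt_one_div (by norm_num) (Real.exp_pos 1)]
            have := Real.exp_one_lt_d9
            norm_num
            linarith
    · rw [one_div (_ ^ j), Real.logb_inv, one_div, inv_pow, Real.logb_inv, neg_neg,
        Real.logb_pow, Real.logb_self_eq_one one_lt_two]
      ring
  exact isEntropyRoot_unique (isEntropyRoot_deltaOne ⟨_, h⟩) h

/-! ### Flips, slices and subcubes -/

open Finset

lemma card_symmDiff_eq {α : Type*} [DecidableEq α] (A C : Finset α) :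
    #(A ∆ C) = #(C \ A) + #(A \ C) := by
  rw [symmDiff_def, sup_eq_union, card_union_of_disjoint disjoint_sdiff_sdiff, add_comm]

variable {ι : Type*}

/-- The part of `A` on which the `i`-th coordinate is `b`. -/
def slice (i : ι) (b : Bool) (A : Finset (ι → Bool)) : Finset (ι → Bool) := {x ∈ A | x i = b}

lemma mem_slice {i : ι} {b : Bool} {A : Finset (ι → Bool)} {x : ι → Bool} :
    x ∈ slice i b A ↔ x ∈ A ∧ x i = b := by simp [slice]

lemma slice_not (i : ι) (b : Bool) (A : Finset (ι → Bool)) :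
    slice i (!b) A = {x ∈ A | ¬ x i = b} := by
  ext x; simp only [mem_slice, mem_filter]; cases b <;> simp

lemma card_slice_add (i : ι) (b : Bool) (A : Finset (ι → Bool)) :
    #(slice i b A) + #(slice i (!b) A) = #A := by
  rw [slice_not]; exact card_filter_add_card_filter_not _

lemma exists_card_slice_le (i : ι) (A : Finset (ι → Bool)) :
    ∃ b, #(slice i b A) ≤ #(slice i (!b) A) := by
  rcases le_total #(slice i false A) #(slice i true A) with h | h
  · exact ⟨false, h⟩
  · exact ⟨true, h⟩

variable [DecidableEq ι]

/-- The vector obtained from `x` by changing its `i`-th coordinate. -/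
def flipAt (i : ι) (x : ι → Bool) : ι → Bool := Function.update x i (!x i)

@[simp] lemma flipAt_same (i : ι) (x : ι → Bool) : flipAt i x i = !x i := by
  simp [flipAt]

lemma flipAt_of_ne {i j : ι} (h : j ≠ i) (x : ι → Bool) : flipAt i x j = x j := by
  simp [flipAt, h]

@[simp] lemma flipAt_flipAt (i : ι) (x : ι → Bool) : flipAt i (flipAt i x) = x := by
  ext j
  by_cases h : j = i
  · subst h; simp
  · simp [flipAt_of_ne h]

lemma flipAt_injective (i : ι) : Function.Injective (flipAt i) :=
  (show Function.Involutive (flipAt i) from flipAt_flipAt i).injective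

lemma flipAt_left_injective (x : ι → Bool) : Function.Injective fun i => flipAt i x := by
  intro i j h
  by_contra hne
  have := congrFun h i
  simp [flipAt_of_ne hne] at this

/-- Flipping a coordinate is a bijection, so corresponding conditions have equal counts. -/
lemma card_filter_flipAt (i : ι) (A B : Finset (ι → Bool)) (p q : (ι → Bool) → Prop)
    [DecidablePred p] [DecidablePred q]
    (h : ∀ x, (x ∈ A ∧ p x) ↔ (flipAt i x ∈ B ∧ q (flipAt i x))) :
    #{x ∈ A | p x} = #{x ∈ B | q x} := by
  refine card_bij (fun x _ => flipAt i x) ?_ ?_ ?_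
  · intro x hx
    simpa using (h x).1 (by simpa using hx)
  · intro x _ y _ hxy
    exact flipAt_injective i hxy
  · intro y hy
    refine ⟨flipAt i y, ?_, by simp⟩
    simpa using (h (flipAt i y)).2 (by simpa using hy)

variable [Fintype ι]

/-- The number of edges in direction `i` that join a point of `A` to a point not in `A`,
counted by their endpoint in `A`. -/
def dirBoundary (i : ι) (A : Finset (ι → Bool)) : ℕ := #{x ∈ A | flipAt i x ∉ A}

/-- The subcube through `w` whose set of free coordinates is `T`. -/
def cube (T : Finset ι) (w : ι → Bool) : Finset (ι → Bool) :=
  Fintype.piFinset fun i => if i ∈ T then univ else {w i}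

lemma mem_cube {T : Finset ι} {w x : ι → Bool} : x ∈ cube T w ↔ ∀ i ∉ T, x i = w i := by
  simp only [cube, Fintype.mem_piFinset]
  refine forall_congr' fun i => ?_
  by_cases h : i ∈ T <;> simp [h]

lemma card_cube (T : Finset ι) (w : ι → Bool) : #(cube T w) = 2 ^ #T := by
  rw [cube, Fintype.card_piFinset]
  have : ∀ i, #(if i ∈ T then (univ : Finset Bool) else {w i}) = if i ∈ T then 2 else 1 := by
    intro i; split_ifs <;> simp
  simp only [this, prod_ite, prod_const, one_pow, mul_one, filter_mem_eq_inter, univ_inter]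

lemma flipAt_mem_cube_iff {T : Finset ι} {w x : ι → Bool} {j : ι} (hj : j ∈ T) :
    flipAt j x ∈ cube T w ↔ x ∈ cube T w := by
  simp only [mem_cube]
  refine forall₂_congr fun i hi => ?_
  rw [flipAt_of_ne (by rintro rfl; exact hi hj)]

lemma flipAt_notMem_cube {T : Finset ι} {w x : ι → Bool} {j : ι} (hj : j ∉ T)
    (hx : x ∈ cube T w) : flipAt j x ∉ cube T w := by
  intro h
  have h1 := mem_cube.1 hx j hj
  have h2 := mem_cube.1 h j hj
  simp [h1] at h2

lemma dirBoundary_cube_of_mem {T : Finset ι} (w : ι → Bool) {j : ι} (hj : j ∈ T) :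
    dirBoundary j (cube T w) = 0 := by
  simp only [dirBoundary, card_eq_zero, filter_eq_empty_iff, not_not]
  intro x hx
  exact (flipAt_mem_cube_iff hj).2 hx

lemma dirBoundary_cube_of_notMem {T : Finset ι} (w : ι → Bool) {j : ι} (hj : j ∉ T) :
    dirBoundary j (cube T w) = 2 ^ #T := by
  rw [dirBoundary, filter_true_of_mem fun x hx => flipAt_notMem_cube hj hx, card_cube]

/-- The boundary in direction `j` splits along any partition of the cube that is invariant
under flipping the coordinate `j`. -/
lemma dirBoundary_split (j : ι) (A : Finset (ι → Bool)) (p : (ι → Bool) → Prop)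
    [DecidablePred p] (hp : ∀ x, p (flipAt j x) ↔ p x) :
    dirBoundary j A = dirBoundary j {x ∈ A | p x} + dirBoundary j {x ∈ A | ¬ p x} := by
  unfold dirBoundary
  rw [← card_filter_add_card_filter_not (s := {x ∈ A | flipAt j x ∉ A}) p]
  congr 2
  · ext x; simp only [mem_filter, hp]; tauto
  · ext x; simp only [mem_filter, hp]; tauto

lemma dirBoundary_slice_add {i j : ι} (h : j ≠ i) (b : Bool) (A : Finset (ι → Bool)) :
    dirBoundary j A = dirBoundary j (slice i b A) + dirBoundary j (slice i (!b) A) := by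
  rw [slice_not]
  exact dirBoundary_split j A _ fun x => by rw [flipAt_of_ne h.symm]

/-- Points of one half either have their mirror image in `A` or contribute to the boundary. -/
lemma card_slice_le (i : ι) (b : Bool) (A : Finset (ι → Bool)) :
    #(slice i b A) ≤ #(slice i (!b) A) + dirBoundary i A := by
  rw [← card_filter_add_card_filter_not (s := slice i b A) fun x => flipAt i x ∈ A]
  refine add_le_add ?_ ?_
  · refine card_le_card_of_injOn (flipAt i) ?_ (flipAt_injective i).injOn
    intro x hx
    simp only [coe_filter, Set.mem_ofPred_eq, mem_slice] at hx
    simp [mem_slice, hx.1.2, hx.2]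
  · refine card_le_card fun x hx => ?_
    simp only [mem_filter, mem_slice] at hx ⊢
    exact ⟨hx.1.1, hx.2⟩

/-! ### The boundary relative to a subcube -/

/-- The number of edges in direction `j` between `A \ C` and `A ∩ C`, for a subcube `C`. -/
def crossEdges (T : Finset ι) (w : ι → Bool) (j : ι) (A : Finset (ι → Bool)) : ℕ :=
  #{x ∈ A \ cube T w | flipAt j x ∈ A ∩ cube T w}

/-- In a free direction of `C`, the boundary of `A ∩ C` within `C` is also that of `C \ A`. -/
lemma dirBoundary_eq_of_mem {T : Finset ι} {w : ι → Bool} {j : ι} (hj : j ∈ T)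
    (A : Finset (ι → Bool)) :
    dirBoundary j A = dirBoundary j (cube T w \ A) + dirBoundary j (A \ cube T w) := by
  rw [dirBoundary_split j A (· ∈ cube T w) fun x => flipAt_mem_cube_iff hj]
  congr 1
  · refine card_filter_flipAt j _ _ _ _ fun x => ?_
    simp only [mem_filter, mem_sdiff, flipAt_mem_cube_iff hj, flipAt_flipAt]
    tauto
  · congr 1
    ext x; simp

/-- In a fixed direction of `C`, every point of `A ∩ C` contributes to the boundary, except those
joined to `A \ C`; these edges are also counted in the boundary of `A \ C`. -/
lemma dirBoundary_add_of_notMem {T : Finset ι} {w : ι → Bool} {j : ι} (hj : j ∉ T)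
    (A : Finset (ι → Bool)) :
    dirBoundary j A + 2 * crossEdges T w j A
      = dirBoundary j (A \ cube T w) + #(A ∩ cube T w) := by
  have h1 : dirBoundary j A = #{x ∈ A ∩ cube T w | flipAt j x ∉ A}
      + #{x ∈ A \ cube T w | flipAt j x ∉ A} := by
    rw [dirBoundary, ← card_filter_add_card_filter_not (s := {x ∈ A | flipAt j x ∉ A})
      (· ∈ cube T w)]
    congr 2
    · ext x; simp only [mem_filter, mem_inter]; tauto
    · ext x; simp only [mem_filter, mem_sdiff]; tauto
  have h2 : #(A ∩ cube T w) = crossEdges T w j A + #{x ∈ A ∩ cube T w | flipAt j x ∉ A} := by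
    rw [← card_filter_add_card_filter_not (s := A ∩ cube T w) fun x => flipAt j x ∈ A]
    congr 1
    refine card_filter_flipAt j _ _ _ _ fun x => ?_
    have := flipAt_notMem_cube (w := w) (x := x) hj
    simp only [mem_inter, mem_sdiff, flipAt_flipAt]
    tauto
  have h3 : dirBoundary j (A \ cube T w) = crossEdges T w j A
      + #{x ∈ A \ cube T w | flipAt j x ∉ A} := by
    rw [dirBoundary, ← card_filter_add_card_filter_not
      (s := {x ∈ A \ cube T w | flipAt j x ∉ A \ cube T w}) fun x => flipAt j x ∈ A, crossEdges]
    congr 2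
    · ext x; simp only [mem_filter, mem_sdiff, mem_inter]; tauto
    · ext x; simp only [mem_filter, mem_sdiff]; tauto
  omega

/-- The exact count of the boundary of `A` in terms of its two differences with a subcube. -/
lemma sum_dirBoundary_add {S T : Finset ι} (hTS : T ⊆ S) (w : ι → Bool)
    (A : Finset (ι → Bool)) :
    ∑ j ∈ S, dirBoundary j A + 2 * ∑ j ∈ S \ T, crossEdges T w j A
      = ∑ j ∈ T, dirBoundary j (cube T w \ A) + ∑ j ∈ S, dirBoundary j (A \ cube T w)
        + #(S \ T) * #(A ∩ cube T w) := by
  rw [← sum_sdiff hTS, ← sum_sdiff hTS (f := fun j => dirBoundary j (A \ cube T w)),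
    sum_congr (s₁ := T) rfl fun j hj => dirBoundary_eq_of_mem (w := w) hj A, sum_add_distrib]
  have : ∑ j ∈ S \ T, dirBoundary j A + 2 * ∑ j ∈ S \ T, crossEdges T w j A
      = ∑ j ∈ S \ T, dirBoundary j (A \ cube T w) + #(S \ T) * #(A ∩ cube T w) := by
    rw [mul_sum, ← sum_add_distrib, sum_congr rfl fun j hj =>
      dirBoundary_add_of_notMem (w := w) (mem_sdiff.1 hj).2 A, sum_add_distrib, sum_const,
      smul_eq_mul]
  omega

/-- A point outside a subcube has at most one neighbour in it. -/
lemma sum_crossEdges_le (S T : Finset ι) (w : ι → Bool) (A : Finset (ι → Bool)) :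
    ∑ j ∈ S \ T, crossEdges T w j A ≤ #(A \ cube T w) := by
  simp only [crossEdges]
  rw [← card_sigma]
  refine card_le_card_of_injOn (fun p => p.2) ?_ ?_
  · rintro ⟨j, x⟩ h
    simp only [coe_sigma, Set.mem_sigma_iff, coe_filter, Set.mem_ofPred_eq] at h
    exact h.2.1
  · rintro ⟨j, x⟩ hx ⟨k, y⟩ hy rfl
    simp only [coe_sigma, Set.mem_sigma_iff, coe_filter, Set.mem_ofPred_eq, mem_coe, mem_inter,
      mem_sdiff] at hx hy
    suffices j = k by rw [this]
    by_contra hne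
    refine hx.2.1.2 (mem_cube.2 fun i hi => ?_)
    by_cases hij : i = j
    · subst hij
      have := mem_cube.1 hy.2.2.2 i hi
      rwa [flipAt_of_ne hne] at this
    · have := mem_cube.1 hx.2.2.2 i hi
      rwa [flipAt_of_ne hij] at this

/-- If a half of `A` is close to a subcube, then `A` is close to the subcube twice as large, up
to the boundary of `A` in the direction that is freed. -/
lemma card_symmDiff_cube_insert_le {T : Finset ι} {w : ι → Bool} {i : ι} (hi : i ∉ T)
    (A : Finset (ι → Bool)) :
    #(A ∆ cube (insert i T) w)
      ≤ 2 * #(slice i (w i) A ∆ cube T w) + dirBoundary i A := by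
  set E := slice i (w i) A ∆ cube T w with hE
  set F := {x ∈ A | flipAt i x ∉ A} with hF
  have hcube : ∀ x, x ∈ cube (insert i T) w ↔
      (x i = w i ∧ x ∈ cube T w) ∨ (x i = !w i ∧ flipAt i x ∈ cube T w) := by
    intro x
    simp only [mem_cube]
    constructor
    · intro h
      by_cases hx : x i = w i
      · refine Or.inl ⟨hx, fun k hk => ?_⟩
        by_cases hki : k = i
        · rw [hki, hx]
        · exact h k (by simp [hk, hki])
      · refine Or.inr ⟨by revert hx; cases x i <;> cases w i <;> simp, fun k hk => ?_⟩
        by_cases hki : k = i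
        · subst hki
          rw [flipAt_same]; revert hx; cases x k <;> cases w k <;> simp
        · rw [flipAt_of_ne hki]; exact h k (by simp [hk, hki])
    · rintro (h | h) k hk
      · exact h.2 k (by simp at hk; tauto)
      · have := h.2 k (by simp at hk; tauto)
        rwa [flipAt_of_ne (by rintro rfl; simp at hk)] at this
  have hsub : A ∆ cube (insert i T) w ⊆
      (E ∪ E.image (flipAt i)) ∪ (slice i (!w i) F ∪ (slice i (w i) F).image (flipAt i)) := by
    intro x hx
    have himg : ∀ G : Finset (ι → Bool), x ∈ G.image (flipAt i) ↔ flipAt i x ∈ G := by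
      intro G
      refine ⟨fun h => ?_, fun h => mem_image.2 ⟨_, h, by simp⟩⟩
      obtain ⟨y, hy, rfl⟩ := mem_image.1 h
      simpa using hy
    have hb : x i = w i ∧ flipAt i x i = (!w i) ∨ x i = (!w i) ∧ flipAt i x i = w i := by
      rw [flipAt_same]; cases x i <;> cases w i <;> simp
    have hne : (!w i) ≠ w i := by cases w i <;> simp
    simp only [mem_union, himg, hE, hF, mem_symmDiff, mem_slice, mem_filter, flipAt_flipAt,
      hcube] at hx ⊢
    generalize (x ∈ A) = p at hx ⊢
    generalize (flipAt i x ∈ A) = q at hx ⊢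
    generalize (x ∈ cube T w) = r at hx ⊢
    generalize (flipAt i x ∈ cube T w) = t at hx ⊢
    rcases hb with ⟨h1, h2⟩ | ⟨h1, h2⟩ <;> simp only [h1, h2, hne, hne.symm] at hx ⊢ <;>
      by_cases p <;> by_cases q <;> by_cases r <;> by_cases t <;> simp_all
  have hFc : #F = dirBoundary i A := rfl
  have h1 := card_le_card hsub
  have h2 := card_union_le (E ∪ E.image (flipAt i))
    (slice i (!w i) F ∪ (slice i (w i) F).image (flipAt i))
  have h3 := card_union_le E (E.image (flipAt i))
  have h4 := card_union_le (slice i (!w i) F) ((slice i (w i) F).image (flipAt i))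
  have h5 : #(E.image (flipAt i)) ≤ #E := card_image_le
  have h6 : #((slice i (w i) F).image (flipAt i)) ≤ #(slice i (w i) F) := card_image_le
  have h7 := card_slice_add i (w i) F
  omega

/-- A set is as close to a subcube as its part in a half of the cube is, up to the size of the
other part. -/
lemma card_symmDiff_cube_le (T : Finset ι) (w : ι → Bool) (i : ι) (b : Bool)
    (A : Finset (ι → Bool)) :
    #(A ∆ cube T w) ≤ #(slice i b A ∆ cube T w) + #(slice i (!b) A) := by
  refine (card_le_card fun x hx => ?_).trans (card_union_le _ _)
  simp only [mem_union, mem_symmDiff, mem_slice] at hx ⊢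
  have : x i = b ∨ x i = !b := by cases x i <;> cases b <;> simp
  tauto

/-! ### The undirected edge-boundary -/

/-- The edges leaving `A` are counted direction by direction. -/
lemma ncard_edgeBoundary {n : ℕ} (A : Finset (Fin n → Bool)) :
    (edgeBoundary A).ncard = ∑ i, dirBoundary i A := by
  have hadj : ∀ x y : Fin n → Bool, (hypercube n).Adj x y ↔ ∃ i, y = flipAt i x := by
    intro x y
    change hammingDist x y = 1 ↔ _
    rw [hammingDist, card_eq_one]
    refine exists_congr fun i => ⟨fun h => ?_, fun h => ?_⟩
    · ext k
      have hk : x k ≠ y k ↔ k = i := by simpa using congrArg (k ∈ ·) h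
      by_cases hki : k = i
      · subst hki
        have := hk.2 rfl
        rw [flipAt_same]; revert this; cases x k <;> cases y k <;> simp
      · rw [flipAt_of_ne hki]
        by_contra hne
        exact hki (hk.1 (Ne.symm hne))
    · subst h
      ext k
      by_cases hki : k = i
      · subst hki; simp
      · simp [flipAt_of_ne hki, hki]
  have hset : edgeBoundary A = ((univ.sigma fun i => {x ∈ A | flipAt i x ∉ A}).image
      fun p : (_ : Fin n) × (Fin n → Bool) => s(p.2, flipAt p.1 p.2) : Finset _) := by
    ext e
    simp only [edgeBoundary, Set.mem_ofPred_eq, coe_image, Set.mem_image, mem_coe, mem_sigma,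
      mem_univ, true_and, mem_filter, Sigma.exists]
    constructor
    · rintro ⟨he, x, y, hx, hy, rfl⟩
      obtain ⟨i, rfl⟩ := (hadj x y).1 ((SimpleGraph.mem_edgeSet _).1 he)
      exact ⟨i, x, ⟨hx, hy⟩, rfl⟩
    · rintro ⟨i, x, ⟨hx, hy⟩, rfl⟩
      exact ⟨(SimpleGraph.mem_edgeSet _).2 ((hadj _ _).2 ⟨i, rfl⟩), x, _, hx, hy, rfl⟩
  rw [hset, Set.ncard_coe_finset, card_image_of_injOn, card_sigma]
  · rfl
  · rintro ⟨i, x⟩ hx ⟨k, y⟩ hy h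
    simp only [coe_sigma, Set.mem_sigma_iff, coe_filter, Set.mem_ofPred_eq] at hx hy
    simp only [Sym2.eq_iff] at h
    rcases h with ⟨rfl, h⟩ | ⟨h, -⟩
    · rw [flipAt_left_injective x h]
    · exact absurd hx.2.1 (h ▸ hy.2.2)

/-! ### The excess and the edge-isoperimetric inequality -/

/-- The excess of the boundary of `A`, in the directions of `S`, over the isoperimetric bound
`|A| (|S| - log₂ |A|)` for subsets of a subcube with free coordinates `S`. It is not divided by
`|A|`, so that it vanishes for the empty set. -/
noncomputable def excess (S : Finset ι) (A : Finset (ι → Bool)) : ℝ :=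
  ∑ i ∈ S, (dirBoundary i A : ℝ) - #S * #A + phi #A

lemma excess_insert {S : Finset ι} {i : ι} (hi : i ∉ S) (b : Bool) (A : Finset (ι → Bool)) :
    excess (insert i S) A = excess S (slice i b A) + excess S (slice i (!b) A)
      + (dirBoundary i A - #A + phi #A - phi #(slice i b A) - phi #(slice i (!b) A)) := by
  have h1 : ∑ j ∈ S, (dirBoundary j A : ℝ) = ∑ j ∈ S, (dirBoundary j (slice i b A) : ℝ)
      + ∑ j ∈ S, (dirBoundary j (slice i (!b) A) : ℝ) := by
    rw [← sum_add_distrib]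
    refine sum_congr rfl fun j hj => ?_
    rw [dirBoundary_slice_add (ne_of_mem_of_not_mem hj hi) b A, Nat.cast_add]
  have h2 : (#A : ℝ) = #(slice i b A) + #(slice i (!b) A) := by
    exact_mod_cast (card_slice_add i b A).symm
  simp only [excess, sum_insert hi, card_insert_of_notMem hi, h1]
  rw [h2]
  push_cast
  ring

/-- For `A` in a subcube with free coordinates `insert i S`, all four terms on the left are
nonnegative: halving the cube distributes the excess over the two halves, the surplus of the
boundary in the halving direction, and an entropy term. -/
lemma le_excess_insert {S : Finset ι} {i : ι} (hi : i ∉ S) {b : Bool} {A : Finset (ι → Bool)}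
    (hb : #(slice i b A) ≤ #(slice i (!b) A)) :
    excess S (slice i b A) + excess S (slice i (!b) A)
        + (dirBoundary i A + #(slice i b A) - #(slice i (!b) A))
        + #(slice i b A) * Real.logb 2 (#A / (2 * #(slice i b A)))
      ≤ excess (insert i S) A := by
  have h1 := phi_add_ge (x := #(slice i b A)) (y := #(slice i (!b) A)) (by positivity)
    (by exact_mod_cast hb)
  have h2 : (#(slice i b A) : ℝ) + #(slice i (!b) A) = #A := by
    exact_mod_cast card_slice_add i b A
  rw [excess_insert hi b A]
  rw [h2] at h1
  linarith

lemma entropy_term_nonneg {x y : ℝ} (hx : 0 ≤ x) (hxy : 2 * x ≤ y) :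
    0 ≤ x * Real.logb 2 (y / (2 * x)) := by
  rcases hx.eq_or_lt with rfl | hx
  · simp
  refine mul_nonneg hx.le (Real.logb_nonneg one_lt_two ?_)
  rwa [one_le_div (by positivity)]

lemma slice_subset_cube {S : Finset ι} {i : ι} {v : ι → Bool} {A : Finset (ι → Bool)}
    (h : A ⊆ cube (insert i S) v) (b : Bool) :
    slice i b A ⊆ cube S (Function.update v i b) := by
  intro x hx
  rw [mem_slice] at hx
  refine mem_cube.2 fun k hk => ?_
  by_cases hki : k = i
  · subst hki; simp [hx.2]
  · rw [Function.update_of_ne hki]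
    exact mem_cube.1 (h hx.1) k (by simp [hk, hki])

/-- The edge-isoperimetric inequality. -/
lemma excess_nonneg {S : Finset ι} {v : ι → Bool} {A : Finset (ι → Bool)} (h : A ⊆ cube S v) :
    0 ≤ excess S A := by
  induction S using Finset.induction_on generalizing v A with
  | empty =>
    have h1 : #A ≤ 1 := by simpa [card_cube] using card_le_card h
    interval_cases hA : #A <;> simp [excess, hA]
  | insert i S hi ih =>
    obtain ⟨b, hb⟩ := exists_card_slice_le i A
    have h1 := le_excess_insert hi hb
    have h2 := ih (slice_subset_cube h b)
    have h3 := ih (slice_subset_cube h (!b))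
    have h4 : (#(slice i (!b) A) : ℝ) ≤ #(slice i b A) + dirBoundary i A := by
      have := card_slice_le i (!b) A
      rw [Bool.not_not] at this
      exact_mod_cast this
    have h5 := card_slice_add i b A
    have h6 := entropy_term_nonneg (x := #(slice i b A)) (y := #A) (by positivity)
      (by exact_mod_cast (by omega : 2 * #(slice i b A) ≤ #A))
    linarith

/-- If `C` is the subcube through `w` with free coordinates `T`, and `d = |C \ A| / |C|` and
`b = |A \ C| / |C|`, then the isoperimetric inequality, applied to `C \ A` inside `C` and to
`A \ C`, bounds the excess of `A` from below. -/
lemma le_excess_of_cube {S T : Finset ι} (hTS : T ⊆ S) {v w : ι → Bool}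
    {A : Finset (ι → Bool)} (hA : A ⊆ cube S v) {d b : ℝ}
    (hd : (#(cube T w \ A) : ℝ) = 2 ^ #T * d) (hb : (#(A \ cube T w) : ℝ) = 2 ^ #T * b) :
    2 ^ #T * (phi (1 - d + b) - phi d - phi b - 2 * b) ≤ excess S A := by
  have hD := excess_nonneg (S := T) (v := w) (A := cube T w \ A) sdiff_subset
  have hB := excess_nonneg (S := S) (v := v) (A := A \ cube T w) (sdiff_subset.trans hA)
  have hsum : ∑ j ∈ S, (dirBoundary j A : ℝ) + 2 * ∑ j ∈ S \ T, (crossEdges T w j A : ℝ)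
      = ∑ j ∈ T, (dirBoundary j (cube T w \ A) : ℝ)
        + ∑ j ∈ S, (dirBoundary j (A \ cube T w) : ℝ)
        + #(S \ T) * #(A ∩ cube T w) := by
    exact_mod_cast sum_dirBoundary_add hTS w A
  have hcross : ∑ j ∈ S \ T, (crossEdges T w j A : ℝ) ≤ #(A \ cube T w) := by
    exact_mod_cast sum_crossEdges_le S T w A
  have hST : (#(S \ T) : ℝ) = #S - #T := by
    rw [card_sdiff_of_subset hTS, Nat.cast_sub (card_le_card hTS)]
  have hAC : (#(A ∩ cube T w) : ℝ) = 2 ^ #T * (1 - d) := by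
    have : (#(cube T w ∩ A) : ℝ) + #(cube T w \ A) = 2 ^ #T := by
      rw [← Nat.cast_add, card_inter_add_card_sdiff, card_cube]; push_cast; rfl
    rw [inter_comm]
    linarith
  have hcard : (#A : ℝ) = 2 ^ #T * (1 - d + b) := by
    have : (#A : ℝ) = #(A ∩ cube T w) + #(A \ cube T w) := by
      rw [← Nat.cast_add, card_inter_add_card_sdiff]
    rw [this, hAC, hb]; ring
  have hK : phi (2 ^ #T) = 2 ^ #T * #T := by
    rw [phi, Real.logb_pow, Real.logb_self_eq_one one_lt_two, mul_one]
  unfold excess at *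
  rw [hd, phi_mul, hK] at hD
  rw [hb, phi_mul, hK] at hB
  rw [hcard, phi_mul, hK]
  rw [hST, hAC] at hsum
  rw [hb] at hcross
  linarith

/-! ### Rough stability -/

/-- A set of small excess that is somewhat close to a subcube is very close to it. -/
lemma card_symmDiff_le_of_excess_le {S T : Finset ι} (hTS : T ⊆ S) {v w : ι → Bool}
    {A : Finset (ι → Bool)} (hA : A ⊆ cube S v) (h : excess S A ≤ 1 / 1000 * #A)
    (hclose : (#(A ∆ cube T w) : ℝ) ≤ 1 / 64 * 2 ^ #T) :
    (#(A ∆ cube T w) : ℝ) ≤ 1 / 1000 * 2 ^ #T := by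
  have hK : (0 : ℝ) < 2 ^ #T := by positivity
  obtain ⟨d, hd⟩ : ∃ d : ℝ, (#(cube T w \ A) : ℝ) = 2 ^ #T * d :=
    ⟨#(cube T w \ A) / 2 ^ #T, by field_simp⟩
  obtain ⟨b, hb⟩ : ∃ b : ℝ, (#(A \ cube T w) : ℝ) = 2 ^ #T * b :=
    ⟨#(A \ cube T w) / 2 ^ #T, by field_simp⟩
  have hd0 : 0 ≤ d := nonneg_of_mul_nonneg_right (hd ▸ Nat.cast_nonneg _) hK
  have hb0 : 0 ≤ b := nonneg_of_mul_nonneg_right (hb ▸ Nat.cast_nonneg _) hK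
  have hs : (#(A ∆ cube T w) : ℝ) = 2 ^ #T * (d + b) := by
    rw [card_symmDiff_eq, Nat.cast_add, hd, hb]; ring
  rw [hs, mul_comm] at hclose ⊢
  have hdb := le_of_mul_le_mul_right hclose hK
  refine mul_le_mul_of_nonneg_right ?_ hK.le
  have hcard : (#A : ℝ) = 2 ^ #T * (1 - d + b) := by
    have h1 : (#(A ∩ cube T w) : ℝ) + #(A \ cube T w) = #A := by
      rw [← Nat.cast_add, card_inter_add_card_sdiff]
    have h2 : (#(cube T w ∩ A) : ℝ) + #(cube T w \ A) = 2 ^ #T := by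
      rw [← Nat.cast_add, card_inter_add_card_sdiff, card_cube]; push_cast; rfl
    rw [inter_comm] at h2
    linarith
  have hlow := (le_excess_of_cube hTS hA hd hb).trans h
  rw [hcard, mul_left_comm] at hlow
  have hlow := le_of_mul_le_mul_left hlow hK
  -- For `d, b ≤ 2⁻⁶` the terms `d log₂ (1/d) + b log₂ (1/b)` dominate the linear losses.
  have h1 := phi_le_of_le_pow (k := 6) hd0 (by norm_num; linarith)
  have h2 := phi_le_of_le_pow (k := 6) hb0 (by norm_num; linarith)
  have h3 := le_phi (a := 1 - d + b) (by linarith)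
  have h4 : -(2 * d) ≤ (1 - d + b - 1) / Real.log 2 := by
    have := Real.log_two_gt_d9
    rw [le_div_iff₀ (by linarith)]
    nlinarith
  norm_num at h1 h2
  linarith

/-- A nonempty set of small excess is close to a subcube. By induction on the dimension: of the
two halves of the cube, either one carries almost all of `A`, or `A` is almost invariant under
the corresponding flip. In both cases a half of small excess yields a subcube that is roughly
close to `A`, and `card_symmDiff_le_of_excess_le` restores the constant. -/
lemma exists_cube_of_excess_le {S : Finset ι} {v : ι → Bool} {A : Finset (ι → Bool)}
    (hA : A ⊆ cube S v) (hne : A.Nonempty) (h : excess S A ≤ 1 / 1000 * #A) :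
    ∃ T ⊆ S, ∃ w ∈ cube S v, (#(A ∆ cube T w) : ℝ) ≤ 1 / 1000 * 2 ^ #T := by
  induction S using Finset.induction_on generalizing v A with
  | empty =>
    refine ⟨∅, subset_rfl, v, mem_cube.2 fun _ _ => rfl, ?_⟩
    have hcard : #(cube ∅ v) ≤ #A := by
      rw [card_cube]; simpa using hne.card_pos
    rw [eq_of_subset_of_card_le hA hcard]
    simp
  | insert i S hi ih =>
    suffices H : ∃ T ⊆ insert i S, ∃ w ∈ cube (insert i S) v,
        (#(A ∆ cube T w) : ℝ) ≤ 1 / 64 * 2 ^ #T by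
      obtain ⟨T, hT, w, hw, hc⟩ := H
      exact ⟨T, hT, w, hw, card_symmDiff_le_of_excess_le hT hA h hc⟩
    have hlift : ∀ b, ∀ w ∈ cube S (Function.update v i b),
        w i = b ∧ w ∈ cube (insert i S) v := by
      intro b w hw
      refine ⟨by simpa using mem_cube.1 hw i hi, mem_cube.2 fun k hk => ?_⟩
      rw [mem_insert, not_or] at hk
      simpa [Function.update_of_ne hk.1] using mem_cube.1 hw k hk.2
    -- A half close to a subcube has comparable size.
    have hsize : ∀ (b : Bool) (T : Finset ι) (w : ι → Bool),
        (#(slice i b A ∆ cube T w) : ℝ) ≤ 1 / 1000 * 2 ^ #T →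
          (#(slice i b A) : ℝ) ≤ 2 * 2 ^ #T := by
      intro b T w hc
      have h1 : #(slice i b A) ≤ #(slice i b A ∆ cube T w) + #(cube T w) := by
        refine (card_le_card fun x hx => ?_).trans (card_union_le _ _)
        simp only [mem_union, mem_symmDiff]
        tauto
      rw [card_cube] at h1
      have h2 : (#(slice i b A) : ℝ) ≤ #(slice i b A ∆ cube T w) + 2 ^ #T := by
        exact_mod_cast h1
      have : (0 : ℝ) < 2 ^ #T := by positivity
      linarith
    obtain ⟨b, hb⟩ := exists_card_slice_le i A
    have hrec := le_excess_insert hi hb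
    have hsub := slice_subset_cube hA b
    have hsub' := slice_subset_cube hA (!b)
    have h0 := excess_nonneg hsub
    have h0' := excess_nonneg hsub'
    have hbd : (#(slice i (!b) A) : ℝ) ≤ #(slice i b A) + dirBoundary i A := by
      have := card_slice_le i (!b) A
      rw [Bool.not_not] at this
      exact_mod_cast this
    have hadd : (#(slice i b A) : ℝ) + #(slice i (!b) A) = #A := by
      exact_mod_cast card_slice_add i b A
    have hbR : (#(slice i b A) : ℝ) ≤ #(slice i (!b) A) := by exact_mod_cast hb
    have hposA : (0 : ℝ) < #A := by exact_mod_cast hne.card_pos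
    have hent := entropy_term_nonneg (x := #(slice i b A)) (y := #A) (by positivity)
      (by linarith)
    by_cases hcase : 3 * #(slice i b A) ≤ #(slice i (!b) A)
    · -- The smaller half is negligible, and the larger half has small excess.
      have hcaseR : 3 * (#(slice i b A) : ℝ) ≤ #(slice i (!b) A) := by exact_mod_cast hcase
      have hlog : (#(slice i b A) : ℝ)
          ≤ #(slice i b A) * Real.logb 2 (#A / (2 * #(slice i b A))) := by
        rcases (Nat.cast_nonneg (α := ℝ) #(slice i b A)).eq_or_lt with hz | hz
        · simp [← hz]
        refine le_mul_of_one_le_right hz.le ?_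
        rw [Real.le_logb_iff_rpow_le one_lt_two (by positivity), Real.rpow_one,
          le_div_iff₀ (by positivity)]
        linarith
      have hne' : (slice i (!b) A).Nonempty := by
        rw [← card_pos]
        have : (0 : ℝ) < #(slice i (!b) A) := by linarith
        exact_mod_cast this
      obtain ⟨T, hT, w, hw, hc⟩ := ih hsub' hne' (by linarith)
      refine ⟨T, hT.trans (subset_insert _ _), w, (hlift _ _ hw).2, ?_⟩
      have h1 : (#(A ∆ cube T w) : ℝ) ≤ #(slice i (!b) A ∆ cube T w) + #(slice i b A) := by
        have := card_symmDiff_cube_le T w i (!b) A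
        rw [Bool.not_not] at this
        exact_mod_cast this
      have h2 := hsize _ _ _ hc
      have : (0 : ℝ) < 2 ^ #T := by positivity
      linarith
    · -- The two halves have almost the same size, and few edges between them are in the boundary.
      have hcaseR : (#(slice i (!b) A) : ℝ) < 3 * #(slice i b A) := by
        exact_mod_cast not_le.1 hcase
      have hz : (0 : ℝ) < #(slice i b A) := by linarith
      have hlog : ((#(slice i (!b) A) : ℝ) - #(slice i b A)) / 2
          ≤ #(slice i b A) * Real.logb 2 (#A / (2 * #(slice i b A))) := by
        have h1 := sub_one_le_logb_two (u := #A / (2 * #(slice i b A)))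
          (by rw [le_div_iff₀ (by positivity)]; linarith)
          (by rw [div_le_iff₀ (by positivity)]; linarith)
        have h2 := mul_le_mul_of_nonneg_left h1 hz.le
        have h3 : (#(slice i b A) : ℝ) * (#A / (2 * #(slice i b A)) - 1)
            = (#(slice i (!b) A) - #(slice i b A)) / 2 := by
          rw [← hadd]; field_simp; ring
        rwa [h3] at h2
      obtain ⟨b', hb', hb'card⟩ : ∃ b', excess S (slice i b' A) ≤ 1 / 1000 * #(slice i b' A)
          ∧ (#A : ℝ) ≤ 4 * #(slice i b' A) := by
        rcases le_or_gt (excess S (slice i b A)) (1 / 1000 * #(slice i b A)) with hle | hgt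
        · exact ⟨b, hle, by linarith⟩
        · exact ⟨!b, by linarith, by linarith⟩
      have hne' : (slice i b' A).Nonempty := by
        rw [← card_pos]
        have : (0 : ℝ) < #(slice i b' A) := by linarith
        exact_mod_cast this
      obtain ⟨T, hT, w, hw, hc⟩ := ih (slice_subset_cube hA b') hne' hb'
      obtain ⟨hwi, hw'⟩ := hlift _ _ hw
      have hiT : i ∉ T := fun hmem => hi (hT hmem)
      refine ⟨insert i T, insert_subset_insert _ hT, w, hw', ?_⟩
      have h1 : (#(A ∆ cube (insert i T) w) : ℝ)
          ≤ 2 * #(slice i b' A ∆ cube T w) + dirBoundary i A := by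
        have := card_symmDiff_cube_insert_le (w := w) hiT A
        rw [hwi] at this
        exact_mod_cast this
      have h2 := hsize _ _ _ hc
      rw [card_insert_of_notMem hiT, pow_succ]
      linarith

/-! ### Exact stability -/

lemma excess_univ {n : ℕ} {A : Finset (Fin n → Bool)} (hA : A.Nonempty) :
    excess univ A = (edgeBoundary A).ncard - #A * Real.logb 2 (2 ^ n / #A) := by
  have : (#A : ℝ) ≠ 0 := by exact_mod_cast hA.card_pos.ne'
  rw [Real.logb_div (by positivity) this, Real.logb_pow, Real.logb_self_eq_one one_lt_two,
    ncard_edgeBoundary, excess, phi, card_univ, Fintype.card_fin]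
  push_cast
  ring

lemma isSubcubeOfCodim_cube {n N : ℕ} {T : Finset (Fin n)} (hT : #T + N = n)
    (w : Fin n → Bool) : IsSubcubeOfCodim N (cube T w) := by
  refine ⟨Tᶜ, w, ?_, fun x => ?_⟩
  · rw [card_compl, Fintype.card_fin]; omega
  · simp [mem_cube]

lemma exists_eq_cube {n K : ℕ} {C : Finset (Fin n → Bool)} (h : IsSubcubeOfCodim K C) :
    ∃ T w, C = cube T w := by
  obtain ⟨S, a, -, hC⟩ := h
  exact ⟨Sᶜ, a, by ext x; simp [hC, mem_cube]⟩

lemma one_div_thousand_lt : (1 / 1000 : ℝ) < 1 / (Real.exp 1 * Real.log 2) := by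
  have he := Real.exp_one_lt_d9
  have he0 := Real.exp_pos 1
  have hl := Real.log_two_lt_d9
  have hl0 := Real.log_pos one_lt_two
  exact one_div_lt_one_div_of_lt (by positivity) (by nlinarith)

/-- Exact stability: once a subcube of the right size is known to be roughly close to `A`,
`le_excess_of_cube` with `d = b = δ / 2` reads `δ log₂ (1 / δ) ≤ ε`. -/
lemma exact_stability {n N : ℕ} (hN : N ≤ n) {A : Finset (Fin n → Bool)}
    (hcard : #A = 2 ^ (n - N)) {ε : ℝ} (hε : ε ≤ 1 / 1000)
    (h : ((edgeBoundary A).ncard : ℝ) ≤ #A * (Real.logb 2 (2 ^ n / #A) + ε)) :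
    ∃ C : Finset (Fin n → Bool), IsSubcubeOfCodim N C ∧
      (#(A ∆ C) : ℝ) ≤ deltaOne ε * #A := by
  have hne : A.Nonempty := by rw [← card_pos, hcard]; positivity
  have hex : excess univ A ≤ ε * #A := by rw [excess_univ hne]; linarith
  have hA : A ⊆ cube univ fun _ => true := fun x _ => mem_cube.2 (by simp)
  obtain ⟨T, -, w, -, hclose⟩ := exists_cube_of_excess_le hA hne
    (hex.trans (mul_le_mul_of_nonneg_right hε (Nat.cast_nonneg _)))
  have hC := card_cube T w
  have h1 : #A + #(cube T w \ A) = #(cube T w) + #(A \ cube T w) := by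
    have h2 := card_inter_add_card_sdiff A (cube T w)
    have h3 := card_inter_add_card_sdiff (cube T w) A
    rw [inter_comm] at h3
    omega
  have hsymm := card_symmDiff_eq A (cube T w)
  -- Two powers of two that differ by so little are equal.
  have hT : #T = n - N := by
    have hlt : 1000 * #(A ∆ cube T w) ≤ 2 ^ #T := by
      have : 1000 * (#(A ∆ cube T w) : ℝ) ≤ 2 ^ #T := by linarith
      exact_mod_cast this
    have hpos : 0 < 2 ^ #T := by positivity
    rcases lt_trichotomy #T (n - N) with hlt' | heq | hlt'
    · have := Nat.pow_le_pow_right two_pos hlt'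
      rw [Nat.succ_eq_add_one, pow_succ] at this
      omega
    · exact heq
    · have := Nat.pow_le_pow_right two_pos hlt'
      rw [Nat.succ_eq_add_one, pow_succ] at this
      omega
  refine ⟨cube T w, isSubcubeOfCodim_cube (by omega) w, ?_⟩
  have hAT : (#A : ℝ) = 2 ^ #T := by rw [hcard, hT]; push_cast; rfl
  have hK : (0 : ℝ) < 2 ^ #T := by positivity
  have hcomm : #(cube T w \ A) = #(A \ cube T w) := by
    rw [hcard, hC, hT] at h1; omega
  obtain ⟨d, hd⟩ : ∃ d : ℝ, (#(A \ cube T w) : ℝ) = 2 ^ #T * d :=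
    ⟨#(A \ cube T w) / 2 ^ #T, by field_simp⟩
  have hd0 : 0 ≤ d := nonneg_of_mul_nonneg_right (hd ▸ Nat.cast_nonneg _) hK
  have hδ : (#(A ∆ cube T w) : ℝ) = 2 * d * 2 ^ #T := by
    rw [hsymm, hcomm, Nat.cast_add, hd]; ring
  have hlow := le_excess_of_cube (subset_univ T) hA (hcomm ▸ hd) hd
  have hphi : phi (2 * d) = 2 * phi d + 2 * d := by
    rw [phi_mul, phi, phi, Real.logb_self_eq_one one_lt_two]; ring
  have hroot : -phi (2 * d) ≤ ε := by
    refine le_of_mul_le_mul_left ?_ hK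
    rw [hAT] at hex
    rw [sub_add_cancel, phi_one] at hlow
    rw [hphi]
    linarith
  rw [hδ, hAT]
  rw [hδ] at hclose
  have hd1 := le_of_mul_le_mul_right hclose hK
  have he := Real.exp_one_lt_d9
  refine mul_le_mul_of_nonneg_right (le_deltaOne ?_ (by positivity) ?_ hroot) hK.le
  · exact hε.trans_lt one_div_thousand_lt
  · exact hd1.trans_lt (one_div_lt_one_div_of_lt (Real.exp_pos 1) (by linarith))

/-! ### Sharpness -/

lemma sum_dirBoundary_cube (S U : Finset ι) (w : ι → Bool) :
    ∑ j ∈ S, dirBoundary j (cube U w) = #(S \ U) * 2 ^ #U := by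
  rw [← sum_inter_add_sum_sdiff S U,
    sum_eq_zero fun j hj => dirBoundary_cube_of_mem w (mem_inter.1 hj).2,
    sum_congr rfl fun j hj => dirBoundary_cube_of_notMem w (mem_sdiff.1 hj).2]
  simp

lemma cube_eq_of_mem {T : Finset ι} {w x : ι → Bool} (hx : x ∈ cube T w) :
    cube T w = cube T x := by
  ext y
  simp only [mem_cube] at hx ⊢
  exact forall₂_congr fun i hi => by rw [hx i hi]

/-- Distinct subcubes of the same dimension share at most half of their points. -/
lemma two_mul_card_inter_cube_le {T T' : Finset ι} {w w' : ι → Bool} (hT : #T = #T')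
    (hne : cube T w ≠ cube T' w') : 2 * #(cube T w ∩ cube T' w') ≤ 2 ^ #T := by
  rcases (cube T w ∩ cube T' w').eq_empty_or_nonempty with h | ⟨x, hx⟩
  · simp [h]
  rw [mem_inter] at hx
  rw [cube_eq_of_mem hx.1, cube_eq_of_mem hx.2] at hne ⊢
  have hinter : cube T x ∩ cube T' x = cube (T ∩ T') x := by
    ext y
    simp only [mem_inter, mem_cube, not_and_or]
    constructor
    · rintro ⟨h1, h2⟩ i (h | h)
      exacts [h1 i h, h2 i h]
    · exact fun h => ⟨fun i hi => h i (Or.inl hi), fun i hi => h i (Or.inr hi)⟩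
  have hlt : #(T ∩ T') < #T := by
    refine lt_of_le_of_ne (card_le_card inter_subset_left) fun h => hne ?_
    have h1 := eq_of_subset_of_card_le inter_subset_left h.ge
    rw [eq_of_subset_of_card_le (inter_eq_left.1 h1) hT.ge]
  rw [hinter, card_cube, ← pow_succ']
  exact Nat.pow_le_pow_right two_pos hlt

lemma card_symmDiff_triangle {α : Type*} [DecidableEq α] (A B C : Finset α) :
    #(A ∆ C) ≤ #(A ∆ B) + #(B ∆ C) := by
  refine (card_le_card fun x hx => ?_).trans (card_union_le _ _)
  simp only [mem_union, mem_symmDiff] at hx ⊢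
  tauto

/-- A set at distance at most `2 ^ t / 2` from a `t`-dimensional subcube, and of the same size,
is at least as far from every other subcube. -/
lemma card_symmDiff_cube_min {T T' : Finset ι} {w w' : ι → Bool} {A : Finset (ι → Bool)}
    (hA : #A = 2 ^ #T) (hclose : 2 * #(A ∆ cube T w) ≤ 2 ^ #T) :
    #(A ∆ cube T w) ≤ #(A ∆ cube T' w') := by
  by_cases heq : cube T w = cube T' w'
  · rw [heq]
  have hC := card_cube T w
  have hC' := card_cube T' w'
  have hs := card_symmDiff_eq A (cube T' w')
  have h2 := card_inter_add_card_sdiff A (cube T' w')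
  have h3 := card_inter_add_card_sdiff (cube T' w') A
  rw [inter_comm] at h3
  rcases lt_trichotomy #T #T' with hlt | hT | hlt
  · have := Nat.pow_le_pow_right two_pos hlt
    rw [Nat.succ_eq_add_one, pow_succ] at this
    omega
  · have h4 := two_mul_card_inter_cube_le hT heq
    have h5 := card_symmDiff_triangle (cube T w) A (cube T' w')
    have h6 := card_symmDiff_eq (cube T w) (cube T' w')
    have h7 := card_inter_add_card_sdiff (cube T w) (cube T' w')
    have h8 := card_inter_add_card_sdiff (cube T' w') (cube T w)
    rw [inter_comm] at h8
    rw [← hT] at hC'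
    rw [symmDiff_comm (cube T w) A] at h5
    omega
  · have := Nat.pow_le_pow_right two_pos hlt
    rw [Nat.succ_eq_add_one, pow_succ] at this
    omega

lemma sdiff_union_swap {α : Type*} [DecidableEq α] {B C D : Finset α} (hD : D ⊆ C)
    (hB : Disjoint B C) :
    C \ ((C \ D) ∪ B) = D ∧ ((C \ D) ∪ B) \ C = B ∧ ((C \ D) ∪ B) ∩ C = C \ D := by
  refine ⟨?_, ?_, ?_⟩ <;> ext x <;> simp only [mem_sdiff, mem_union, mem_inter]
  all_goals
    have h1 : x ∈ D → x ∈ C := fun h => hD h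
    have h2 : x ∈ B → x ∉ C := fun h => disjoint_left.1 hB h
    tauto

/-- The extremal sets: from a subcube `C` of codimension `N`, a subcube of `C` of relative
codimension `j + 1` is removed, and a subcube of the same dimension is added, every point of which
is adjacent to a point that remains. -/
lemma exists_extremal {N j : ℕ} (hN : 1 ≤ N) (hn : N + j + 1 ≤ Fintype.card ι) :
    ∃ (T : Finset ι) (w : ι → Bool) (A : Finset (ι → Bool)) (u : ℕ),
      #T + N = Fintype.card ι ∧ u + j + 1 = #T ∧ #A = 2 ^ #T ∧
      #(A ∆ cube T w) = 2 * 2 ^ u ∧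
      ∑ i, dirBoundary i A = N * 2 ^ #T + 2 * j * 2 ^ u := by
  obtain ⟨P, -, hP⟩ := exists_subset_card_eq (s := (univ : Finset ι)) (n := N)
    (by rw [card_univ]; omega)
  have hTc : #Pᶜ + N = Fintype.card ι := by rw [card_compl]; omega
  obtain ⟨R, hRP, hR⟩ := exists_subset_card_eq (s := Pᶜ) (n := j + 1) (by omega)
  obtain ⟨p, hp⟩ : P.Nonempty := card_pos.1 (by omega)
  obtain ⟨r, hr⟩ : R.Nonempty := card_pos.1 (by omega)
  have hrP : r ∉ P := mem_compl.1 (hRP hr)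
  set T := Pᶜ with hT
  set U := T \ R with hU
  have hUc : #U + (j + 1) = #T := by
    rw [hU, card_sdiff_of_subset hRP, hR]; omega
  set w : ι → Bool := fun _ => true with hw
  -- The added subcube is reflected out of `C` in the direction `p`; the reflection of its points
  -- in this direction avoids the removed subcube because of the coordinate `r`.
  set z : ι → Bool := fun i => decide (i ≠ p ∧ i ≠ r) with hz
  have hpT : p ∉ T := by simp [hT, hp]
  have hrU : r ∉ U := by simp [hU, hr]
  have hUT : U ⊆ T := sdiff_subset
  have hDC : cube U w ⊆ cube T w := fun x hx =>
    mem_cube.2 fun i hi => mem_cube.1 hx i fun h => hi (hUT h)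
  have hBC : ∀ x ∈ cube U z, x ∉ cube T w := by
    intro x hx hx'
    have h1 := mem_cube.1 hx p fun h => hpT (hUT h)
    have h2 := mem_cube.1 hx' p hpT
    simp [h1, hz, hw] at h2
  set A := (cube T w \ cube U w) ∪ cube U z with hA
  obtain ⟨hCA, hAC, hinter⟩ := sdiff_union_swap hDC (disjoint_left.2 hBC)
  rw [← hA] at hCA hAC hinter
  have hAcard : #(A ∩ cube T w) + 2 ^ #U = 2 ^ #T := by
    have := card_sdiff_add_card_eq_card hDC
    rwa [← hinter, card_cube, card_cube] at this
  have hA' := card_inter_add_card_sdiff A (cube T w)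
  rw [hAC, card_cube] at hA'
  refine ⟨T, w, A, #U, hTc, by omega, by omega, ?_, ?_⟩
  · rw [card_symmDiff_eq, hCA, hAC, card_cube, card_cube]; ring
  have hcross : ∑ i ∈ univ \ T, crossEdges T w i A = 2 ^ #U := by
    refine le_antisymm ?_ ?_
    · have := sum_crossEdges_le univ T w A
      rwa [hAC, card_cube] at this
    · have hpm : p ∈ univ \ T := by simp [hpT]
      refine le_trans ?_ (single_le_sum (fun i _ => Nat.zero_le _) hpm)
      rw [crossEdges, hAC, hinter, filter_true_of_mem, card_cube]
      intro x hx
      refine mem_sdiff.2 ⟨mem_cube.2 fun i hi => ?_, fun h => ?_⟩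
      · by_cases hip : i = p
        · subst hip
          rw [flipAt_same, mem_cube.1 hx i fun h => hi (hUT h)]
          simp [hz, hw]
        · rw [flipAt_of_ne hip, mem_cube.1 hx i fun h => hi (hUT h)]
          have hir : i ≠ r := by
            rintro rfl; exact hi (hRP hr)
          simp [hz, hw, hip, hir]
      · have hrp : r ≠ p := by rintro rfl; exact hrP hp
        have := mem_cube.1 h r hrU
        rw [flipAt_of_ne hrp, mem_cube.1 hx r hrU] at this
        simp [hz, hw] at this
  have hsum := sum_dirBoundary_add (subset_univ T) w A
  rw [hcross, hCA, hAC, sum_dirBoundary_cube, sum_dirBoundary_cube] at hsum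
  have e1 : #(T \ U) = j + 1 := by rw [card_sdiff_of_subset hUT]; omega
  have e2 : #(univ \ U) = N + j + 1 := by
    rw [card_sdiff_of_subset (subset_univ _), card_univ]; omega
  have e3 : #(univ \ T) = N := by
    rw [card_sdiff_of_subset (subset_univ _), card_univ]; omega
  rw [e1, e2, e3] at hsum
  rw [← hAcard]
  linarith

lemma sharpness {n N j : ℕ} (hN : 1 ≤ N) (hj : 1 ≤ j) (hn : N + j + 1 ≤ n) :
    ∃ A : Finset (Fin n → Bool), #A = 2 ^ (n - N) ∧
      ((edgeBoundary A).ncard : ℝ) =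
        #A * (Real.logb 2 (2 ^ n / #A) + j * (1 / 2 : ℝ) ^ j) ∧
      (∃ C : Finset (Fin n → Bool), IsSubcubeOfCodim N C ∧
        (#(A ∆ C) : ℝ) = (1 / 2 : ℝ) ^ j * #A) ∧
      ∀ (K : ℕ) (C : Finset (Fin n → Bool)), IsSubcubeOfCodim K C →
        (1 / 2 : ℝ) ^ j * #A ≤ #(A ∆ C) := by
  obtain ⟨T, w, A, u, hTN, hu, hA, hAC, hsum⟩ :=
    exists_extremal (ι := Fin n) hN (by rwa [Fintype.card_fin])
  rw [Fintype.card_fin] at hTN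
  have hpow : (2 : ℝ) ^ j * (1 / 2) ^ j = 1 := by rw [← mul_pow]; norm_num
  have hAR : (#A : ℝ) = 2 * 2 ^ u * 2 ^ j := by
    rw [hA, ← hu]; push_cast; ring
  have hhalf : (1 / 2 : ℝ) ^ j * #A = 2 * 2 ^ u := by
    rw [hAR]; linear_combination (2 * 2 ^ u) * hpow
  have hACR : (#(A ∆ cube T w) : ℝ) = (1 / 2 : ℝ) ^ j * #A := by
    rw [hhalf, hAC]; push_cast; ring
  refine ⟨A, by rw [hA]; congr 1; omega, ?_,
    ⟨cube T w, isSubcubeOfCodim_cube hTN w, hACR⟩, ?_⟩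
  · have hlog : Real.logb 2 (2 ^ n / #A) = N := by
      have h2n : (2 : ℝ) ^ n = 2 ^ #T * 2 ^ N := by rw [← pow_add, hTN]
      rw [hA, h2n]
      push_cast
      rw [mul_div_cancel_left₀ _ (by positivity), Real.logb_pow,
        Real.logb_self_eq_one one_lt_two, mul_one]
    rw [hlog, mul_add, mul_left_comm, mul_comm (#A : ℝ) (_ ^ _), hhalf, ncard_edgeBoundary, hsum,
      hA]
    push_cast
    ring
  · intro K C hC
    obtain ⟨T', w', rfl⟩ := exists_eq_cube hC
    rw [← hACR]
    have hclose : 2 * #(A ∆ cube T w) ≤ 2 ^ #T := by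
      rw [hAC, ← hu]
      calc 2 * (2 * 2 ^ u) = 2 ^ (u + 2) := by ring
        _ ≤ 2 ^ (u + j + 1) := Nat.pow_le_pow_right two_pos (by omega)
    exact_mod_cast card_symmDiff_cube_min hA hclose

end Hypercube

theorem mainTheorem2 :
    -- `δ₁` is well defined: the root exists and is unique, and `deltaOne` is that root
    (∀ ε : ℝ, 0 < ε → ε < 1 / (Real.exp 1 * Real.log 2) →
      IsEntropyRoot ε (deltaOne ε) ∧ ∀ x : ℝ, IsEntropyRoot ε x → x = deltaOne ε) ∧
    -- exact stability
    (∃ c : ℝ, 0 < c ∧ c < 1 / (Real.exp 1 * Real.log 2) ∧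
      ∀ (n N : ℕ), N ≤ n → ∀ A : Finset (Fin n → Bool), A.card = 2 ^ (n - N) →
        ∀ ε : ℝ, ε ≤ c →
          ((edgeBoundary A).ncard : ℝ) ≤
            (A.card : ℝ) * (Real.logb 2 ((2 : ℝ) ^ n / (A.card : ℝ)) + ε) →
          ∃ C : Finset (Fin n → Bool), IsSubcubeOfCodim N C ∧
            ((A ∆ C).card : ℝ) ≤ deltaOne ε * (A.card : ℝ)) ∧
    -- sharpness, at `δ = 2 ^ (-j)`
    (∀ (n N j : ℕ), 1 ≤ N → 1 ≤ j → N + j + 1 ≤ n →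
      ∃ A : Finset (Fin n → Bool), A.card = 2 ^ (n - N) ∧
        ((edgeBoundary A).ncard : ℝ) =
          (A.card : ℝ) * (Real.logb 2 ((2 : ℝ) ^ n / (A.card : ℝ)) + (j : ℝ) * (1 / 2 : ℝ) ^ j) ∧
        (∃ C : Finset (Fin n → Bool), IsSubcubeOfCodim N C ∧
          ((A ∆ C).card : ℝ) = (1 / 2 : ℝ) ^ j * (A.card : ℝ)) ∧
        (∀ (K : ℕ) (C : Finset (Fin n → Bool)), IsSubcubeOfCodim K C →
          (1 / 2 : ℝ) ^ j * (A.card : ℝ) ≤ ((A ∆ C).card : ℝ))) ∧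
    (∀ j : ℕ, 2 ≤ j → deltaOne ((j : ℝ) * (1 / 2 : ℝ) ^ j) = (1 / 2 : ℝ) ^ j) := by
  refine ⟨fun ε h0 h1 => ?_, ⟨1 / 1000, by norm_num, Hypercube.one_div_thousand_lt, ?_⟩, ?_, ?_⟩
  · have hroot := Hypercube.isEntropyRoot_deltaOne (Hypercube.exists_isEntropyRoot h0 h1)
    exact ⟨hroot, fun x hx => Hypercube.isEntropyRoot_unique hx hroot⟩
  · intro n N hN A hA ε hε h
    exact Hypercube.exact_stability hN hA hε h
  · intro n N j hN hj hn
    exact Hypercube.sharpness hN hj hn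
  · exact fun j hj => Hypercube.deltaOne_two_pow hj
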